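/- For a real matrix $M$ let $\|M\|_F$ denote its Frobenius norm. For a matrix $\Delta\in\mathbb R^{d\times d}$ and a random matrix $G=[g_1,\dots,g_\ell]\in\mathbb R^{d\times \ell}$ let $\mathrm{Hutch}_\ell(\Delta)=\frac1\ell\sum_{i=1}^{\ell} g_i^T\Delta g_i$ be Hutchinson's estimator. The entries of $G$ are i.i.d. random variables with mean $0$, variance $1$ and sub-Gaussian parameter $K$, i.e. $\mathbb E[e^{tG_{ij}}]\le e^{Kt^2/2}$ for all $t\in\mathbb R$ (for instance random signs or standard Gaussians, with $K=1$). **Theorem.** For every $K$ there are constants $c,C,C_0>0$, depending only on $K$, such that the following holds. Let $A\in\mathbb R^{d\times d}$ be symmetric positive semidefinite, $\delta\in(0,\frac12)$, $\ell,k\in\mathbb N$ with $k\ge1$, and let $A_k$ be an optimal rank-$k$ approximation of $A$, i.e. a minimizer of $\|A-B\|_F$ over all $B\in\mathbb R^{d\times d}$ of rank at most $k$. Let $\tilde A$ be any (fixed) real square matrix, possibly of a different size, and $\Delta\in\mathbb R^{d\times d}$ any fixed matrix such that $$\mathrm{tr}(A)=\mathrm{tr}(\tilde A)+\mathrm{tr}(\Delta)\qquad\text{and}\qquad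 \|\Delta\|_F\le 2\,\|A-A_k\|_F ,$$ and put $Z=\mathrm{tr}(\tilde A)+\mathrm{Hutch}_\ell(\Delta)$. (1) If $\ell>c\log(1/\delta)$, then with probability at least $1-\delta$, $$|Z-\mathrm{tr}(A)|\le 2C\sqrt{\frac{\log(1/\delta)}{k\,\ell}}\;\mathrm{tr}(A).$$ (2) In particular, for every $\epsilon>0$, if $k=\ell\ge C_0\left(\frac{\sqrt{\log(1/\delta)}}{\epsilon}+\log(1/\delta)\right)$ (so that $k=\ell=O\!\left(\frac{\sqrt{\log(1/\delta)}}{\epsilon}+\log(1/\delta)\right)$ suffices), then with probability at least $1-\delta$, $$(1-\epsilon)\,\mathrm{tr}(A)\le Z\le(1+\epsilon)\,\mathrm{tr}(A).$$ -/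

import Mathlib

open MeasureTheory ProbabilityTheory
open scoped NNReal Matrix

-- The norm `‖·‖` of a real matrix is the Frobenius norm.
attribute [local instance] Matrix.frobeniusNormedAddCommGroup

/-- Hutchinson's trace estimator for the square matrix `A` with query matrix
`G = [g₁, …, g_ℓ]`: the average of the quadratic forms `gᵢᵀ A gᵢ`. -/
noncomputable def hutch {d ℓ : ℕ} (G : Matrix (Fin d) (Fin ℓ) ℝ)
    (A : Matrix (Fin d) (Fin d) ℝ) : ℝ :=
  (1 / (ℓ : ℝ)) * ∑ i : Fin ℓ, (fun a => G a i) ⬝ᵥ (A *ᵥ (fun a => G a i))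

/-- `G` is a random `d × ℓ` matrix whose entries are i.i.d. random variables with mean `0`,
variance `1` and sub-Gaussian parameter `K`, that is `𝔼[exp (t Gᵢⱼ)] ≤ exp (K t² / 2)` for
all real `t`. -/
structure IsSubgaussianQueryMatrix {Ω : Type*} [MeasurableSpace Ω] {d ℓ : ℕ} (K : ℝ≥0)
    (G : Ω → Matrix (Fin d) (Fin ℓ) ℝ) (μ : Measure Ω) : Prop where
  measurable : ∀ i j, Measurable (fun ω => G ω i j)
  indep : iIndepFun (fun (p : Fin d × Fin ℓ) (ω : Ω) => G ω p.1 p.2) μ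
  identDistrib : ∀ i j i' j', IdentDistrib (fun ω => G ω i j) (fun ω => G ω i' j') μ μ
  mean_zero : ∀ i j, ∫ ω, G ω i j ∂μ = 0
  variance_one : ∀ i j, variance (fun ω => G ω i j) μ = 1
  subgaussian : ∀ i j, HasSubgaussianMGF (fun ω => G ω i j) K μ

/-- `Ak` is an optimal rank-`k` approximation of `A` in the Frobenius norm: a minimizer of
`‖A - B‖_F` over the matrices `B` of rank at most `k`. -/
def IsBestRankApprox {d : ℕ} (k : ℕ) (A Ak : Matrix (Fin d) (Fin d) ℝ) : Prop :=
  Ak.rank ≤ k ∧ ∀ B : Matrix (Fin d) (Fin d) ℝ, B.rank ≤ k → ‖A - Ak‖ ≤ ‖A - B‖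

/-!
The theorem combines a Hanson–Wright type concentration inequality for Hutchinson's estimator with
the low-rank bound `‖A - Aₖ‖_F ≤ tr A / √k`.

*Concentration.* For fixed `Δ`, the estimator is the average of `ℓ` independent copies of the
quadratic form `gᵀ Δ g`, and `tr Δ` is its mean. It suffices to bound
`𝔼 exp (t (gᵀ Δ g - tr Δ)) ≤ exp (O(κ² t² ‖Δ‖_F²))` for `κ |t| ‖Δ‖_F` below an absolute constant
(`lintegral_exp_quadratic_form_le`): the product over the columns and a Chernoff bound then give
the deviation `O(‖Δ‖_F √(log (1/δ) / ℓ))` as soon as `ℓ ≥ (32κ)² log (1/δ)`, since this makes the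
optimal `t` admissible. Only the Frobenius norm is needed here, not the operator norm of the full
Hanson–Wright inequality, and the exponential moment can be bounded without decoupling. Ordering
the coordinates, `gᵀ Δ g - tr Δ` is a sum of martingale increments `Δᵢᵢ (gᵢ² - 1) + gᵢ cᵢ`, where
`cᵢ` is a linear form in the earlier coordinates. By Cauchy–Schwarz its exponential moment is
controlled by that of an exponential supermartingale (`lintegral_exp_sum_le_one`) and that of the
compensator `∑ᵢ cᵢ²`, a sum of squares of sub-Gaussian variables, which convexity of `exp` reduces
to a single square (`lintegral_exp_mul_sum_sq_le`).

*Low rank.* Truncating the spectral decomposition of `A` to the eigenvalues above `tr A / k` leaves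
a remainder whose squared eigenvalues sum to at most `(tr A)² / k`
(`IsBestRankApprox.sq_norm_sub_mul_le`). Hence `‖Δ‖_F ≤ 2 tr A / √k`, and the deviation above
becomes relative to `tr A`; taking `k = ℓ` gives the second part.
-/

/-! ### Exponential moments -/

/-- The Cauchy–Schwarz inequality for exponential moments. -/
lemma lintegral_exp_add_le {Ω : Type*} [MeasurableSpace Ω] {μ : Measure Ω} {f g : Ω → ℝ}
    (hf : Measurable f) (hg : Measurable g) {a b : ℝ}
    (ha : ∫⁻ ω, ENNReal.ofReal (Real.exp (2 * f ω)) ∂μ ≤ ENNReal.ofReal (Real.exp (2 * a)))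
    (hb : ∫⁻ ω, ENNReal.ofReal (Real.exp (2 * g ω)) ∂μ ≤ ENNReal.ofReal (Real.exp (2 * b))) :
    ∫⁻ ω, ENNReal.ofReal (Real.exp (f ω + g ω)) ∂μ ≤ ENNReal.ofReal (Real.exp (a + b)) := by
  -- The weights make both terms of the arithmetic-geometric mean inequality equal to
  -- `exp (a + b) / 2` in the extremal case.
  have key : ∀ ω, Real.exp (f ω + g ω) ≤ Real.exp (b - a) / 2 * Real.exp (2 * f ω)
      + Real.exp (a - b) / 2 * Real.exp (2 * g ω) := by
    intro ω
    have h1 : Real.exp (b - a) * Real.exp (2 * f ω) = Real.exp ((b - a) / 2 + f ω) ^ 2 := by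
      rw [← Real.exp_add, ← Real.exp_nat_mul]; congr 1; push_cast; ring
    have h2 : Real.exp (a - b) * Real.exp (2 * g ω) = Real.exp ((a - b) / 2 + g ω) ^ 2 := by
      rw [← Real.exp_add, ← Real.exp_nat_mul]; congr 1; push_cast; ring
    have h3 : Real.exp (f ω + g ω)
        = Real.exp ((b - a) / 2 + f ω) * Real.exp ((a - b) / 2 + g ω) := by
      rw [← Real.exp_add]; congr 1; ring
    nlinarith [sq_nonneg (Real.exp ((b - a) / 2 + f ω) - Real.exp ((a - b) / 2 + g ω))]
  calc ∫⁻ ω, ENNReal.ofReal (Real.exp (f ω + g ω)) ∂μ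
      ≤ ∫⁻ ω, (ENNReal.ofReal (Real.exp (b - a) / 2) * ENNReal.ofReal (Real.exp (2 * f ω))
        + ENNReal.ofReal (Real.exp (a - b) / 2) * ENNReal.ofReal (Real.exp (2 * g ω))) ∂μ := by
        refine lintegral_mono fun ω => ?_
        rw [← ENNReal.ofReal_mul (by positivity), ← ENNReal.ofReal_mul (by positivity),
          ← ENNReal.ofReal_add (by positivity) (by positivity)]
        exact ENNReal.ofReal_le_ofReal (key ω)
    _ = ENNReal.ofReal (Real.exp (b - a) / 2) * ∫⁻ ω, ENNReal.ofReal (Real.exp (2 * f ω)) ∂μ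
        + ENNReal.ofReal (Real.exp (a - b) / 2) *
          ∫⁻ ω, ENNReal.ofReal (Real.exp (2 * g ω)) ∂μ := by
        rw [lintegral_add_left (by fun_prop), lintegral_const_mul _ (by fun_prop),
          lintegral_const_mul _ (by fun_prop)]
    _ ≤ ENNReal.ofReal (Real.exp (b - a) / 2) * ENNReal.ofReal (Real.exp (2 * a))
        + ENNReal.ofReal (Real.exp (a - b) / 2) * ENNReal.ofReal (Real.exp (2 * b)) := by
        gcongr
    _ = ENNReal.ofReal (Real.exp (a + b)) := by
        rw [← ENNReal.ofReal_mul (by positivity), ← ENNReal.ofReal_mul (by positivity),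
          ← ENNReal.ofReal_add (by positivity) (by positivity), div_mul_eq_mul_div,
          div_mul_eq_mul_div, ← Real.exp_add, ← Real.exp_add]
        congr 1
        rw [show b - a + 2 * a = a + b by ring, show a - b + 2 * b = a + b by ring]
        ring

lemma lintegral_exp_mul_le_of_hasSubgaussianMGF {Ω : Type*} [MeasurableSpace Ω] {μ : Measure Ω}
    {X : Ω → ℝ} {p : ℝ≥0} (hX : HasSubgaussianMGF X p μ) (t : ℝ) :
    ∫⁻ ω, ENNReal.ofReal (Real.exp (t * X ω)) ∂μ ≤ ENNReal.ofReal (Real.exp (p * t ^ 2 / 2)) := by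
  rw [← ofReal_integral_eq_lintegral_ofReal (hX.integrable_exp_mul t)
    (ae_of_all _ fun ω => (Real.exp_pos _).le)]
  exact ENNReal.ofReal_le_ofReal (hX.mgf_le t)

lemma lintegral_exp_mul_sq_gaussianReal_le {q : ℝ} (hq0 : 0 ≤ q) (hq : q ≤ 1 / 4) :
    ∫⁻ x, ENNReal.ofReal (Real.exp (q * x ^ 2)) ∂(gaussianReal 0 1)
      ≤ ENNReal.ofReal (1 + 2 * q) := by
  have hpos : 0 < 1 / 2 - q := by linarith
  rw [gaussianReal_of_var_ne_zero _ one_ne_zero,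
    lintegral_withDensity_eq_lintegral_mul _ (measurable_gaussianPDF _ _) (by fun_prop)]
  have h1 : ∀ x : ℝ, (gaussianPDF 0 1 * fun x => ENNReal.ofReal (Real.exp (q * x ^ 2))) x
      = ENNReal.ofReal ((√(2 * Real.pi))⁻¹ * Real.exp (-(1 / 2 - q) * x ^ 2)) := by
    intro x
    simp only [Pi.mul_apply, gaussianPDF, gaussianPDFReal]
    rw [← ENNReal.ofReal_mul (by positivity), mul_assoc, ← Real.exp_add]
    congr 2
    · simp
    · congr 1
      push_cast
      ring
  simp_rw [h1]
  rw [← ofReal_integral_eq_lintegral_ofReal ((integrable_exp_neg_mul_sq hpos).const_mul _)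
    (ae_of_all _ fun ω => by positivity), integral_const_mul, integral_gaussian]
  refine ENNReal.ofReal_le_ofReal ?_
  rw [inv_mul_le_iff₀ (by positivity), Real.sqrt_le_left (by positivity), mul_pow,
    Real.sq_sqrt (by positivity), div_le_iff₀ hpos]
  have h2 : 1 ≤ 2 * (1 + 2 * q) ^ 2 * (1 / 2 - q) := by
    nlinarith [mul_nonneg hq0 hq0, mul_nonneg hq0 (sub_nonneg.2 hq),
      mul_nonneg (mul_nonneg hq0 hq0) (sub_nonneg.2 hq)]
  nlinarith [Real.pi_pos]

/-- The square of a sub-Gaussian variable has exponential moments. The square is linearised by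
`exp (u x²) = 𝔼 exp (√(2u) x g)`, with `g` a standard Gaussian, and the two expectations are
interchanged. -/
lemma lintegral_exp_mul_sq_le_of_hasSubgaussianMGF {Ω : Type*} [MeasurableSpace Ω]
    {μ : Measure Ω} [IsProbabilityMeasure μ] {X : Ω → ℝ} (hm : Measurable X) {p : ℝ≥0}
    (hX : HasSubgaussianMGF X p μ) {u : ℝ} (hu : 0 ≤ u) (hup : u * p ≤ 1 / 4) :
    ∫⁻ ω, ENNReal.ofReal (Real.exp (u * X ω ^ 2)) ∂μ ≤ ENNReal.ofReal (1 + 2 * (u * p)) := by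
  have h1 : ∀ ω, ENNReal.ofReal (Real.exp (u * X ω ^ 2))
      = ∫⁻ x, ENNReal.ofReal (Real.exp (√(2 * u) * X ω * x)) ∂(gaussianReal 0 1) := by
    intro ω
    rw [← ofReal_integral_eq_lintegral_ofReal (integrable_exp_mul_gaussianReal _)
      (ae_of_all _ fun x => (Real.exp_pos _).le)]
    have := congrFun (mgf_id_gaussianReal (μ := 0) (v := 1)) (√(2 * u) * X ω)
    simp only [mgf, id] at this
    rw [this, mul_pow, Real.sq_sqrt (by positivity)]
    congr 2
    push_cast
    ring
  simp_rw [h1]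
  rw [lintegral_lintegral_swap (by fun_prop)]
  refine le_trans (lintegral_mono fun x => ?_)
    (lintegral_exp_mul_sq_gaussianReal_le (mul_nonneg hu p.2) hup)
  have h2 := lintegral_exp_mul_le_of_hasSubgaussianMGF hX (√(2 * u) * x)
  rw [mul_pow, Real.sq_sqrt (by positivity)] at h2
  rw [show u * p * x ^ 2 = p * (2 * u * x ^ 2) / 2 by ring]
  simpa only [mul_right_comm] using h2

lemma exp_le_one_add_add_sq_mul_exp_abs (y : ℝ) :
    Real.exp y ≤ 1 + y + y ^ 2 * Real.exp |y| := by
  have h := Complex.norm_exp_sub_sum_le_norm_mul_exp (y : ℂ) 2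
  simp only [Finset.sum_range_succ, Finset.sum_range_zero] at h
  have h2 : Complex.exp y - (0 + (y : ℂ) ^ 0 / (Nat.factorial 0 : ℂ)
      + (y : ℂ) ^ 1 / (Nat.factorial 1 : ℂ)) = ((Real.exp y - (1 + y) : ℝ) : ℂ) := by
    push_cast
    simp
  rw [h2, Complex.norm_real, Complex.norm_real, Real.norm_eq_abs, Real.norm_eq_abs, sq_abs] at h
  linarith [le_abs_self (Real.exp y - (1 + y))]

/-- A centred square of a sub-Gaussian variable is sub-exponential: its moment generating function
has no linear term, by the second-order Taylor bound for `exp`. -/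
lemma lintegral_exp_mul_sq_sub_one_le {Ω : Type*} [MeasurableSpace Ω]
    {μ : Measure Ω} [IsProbabilityMeasure μ] {X : Ω → ℝ} (hm : Measurable X) {κ : ℝ≥0}
    (hκ : 1 ≤ κ) (hX : HasSubgaussianMGF X κ μ) (hsq : ∫ ω, X ω ^ 2 ∂μ = 1) {t : ℝ}
    (ht : |t| * (8 * κ) ≤ 1) :
    ∫⁻ ω, ENNReal.ofReal (Real.exp (t * (X ω ^ 2 - 1))) ∂μ
      ≤ ENNReal.ofReal (Real.exp (384 * κ ^ 2 * t ^ 2)) := by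
  have hκ0 : (0 : ℝ) < κ := by linarith
  set τ : ℝ := 1 / (8 * κ) with hτ
  have hτ0 : 0 < τ := by positivity
  have hτκ : τ * κ = 1 / 8 := by rw [hτ]; field_simp
  have htτ : |t| ≤ τ := by rw [hτ, le_div_iff₀ (by positivity)]; exact ht
  have hE := lintegral_exp_mul_sq_le_of_hasSubgaussianMGF hm hX (u := 2 * τ) (by positivity)
    (by nlinarith)
  have hint : Integrable (fun ω => Real.exp (2 * τ * X ω ^ 2)) μ := by
    refine ⟨by fun_prop, ?_⟩
    rw [hasFiniteIntegral_iff_ofReal (ae_of_all _ fun ω => (Real.exp_pos _).le)]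
    exact hE.trans_lt ENNReal.ofReal_lt_top
  have hE' : ∫ ω, Real.exp (2 * τ * X ω ^ 2) ∂μ ≤ 3 / 2 := by
    rw [← ofReal_integral_eq_lintegral_ofReal hint (ae_of_all _ fun ω => (Real.exp_pos _).le),
      ENNReal.ofReal_le_ofReal_iff (by positivity)] at hE
    nlinarith
  have hsqi : Integrable (fun ω => X ω ^ 2) μ := (hX.memLp 2).integrable_sq
  -- With `z = τ (x² + 1)` one has `|t (x² - 1)| ≤ (|t| / τ) z ≤ z` and `z² ≤ 2 exp z`.
  have key : ∀ x : ℝ, Real.exp (t * (x ^ 2 - 1))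
      ≤ 1 + t * (x ^ 2 - 1) + 256 * κ ^ 2 * t ^ 2 * Real.exp (2 * τ * x ^ 2) := by
    intro x
    refine (exp_le_one_add_add_sq_mul_exp_abs _).trans (add_le_add_right ?_ _)
    have hx : |x ^ 2 - 1| ≤ x ^ 2 + 1 := by
      rw [abs_le]; constructor <;> nlinarith [sq_nonneg x]
    have h1 : |t * (x ^ 2 - 1)| ≤ τ * (x ^ 2 + 1) := by
      rw [abs_mul]; gcongr
    have h2 : (τ * (x ^ 2 + 1)) ^ 2 ≤ 2 * Real.exp (τ * (x ^ 2 + 1)) := by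
      have := Real.quadratic_le_exp_of_nonneg (x := τ * (x ^ 2 + 1)) (by positivity)
      have h0 : 0 ≤ τ * (x ^ 2 + 1) := by positivity
      nlinarith
    have h3 : (x ^ 2 - 1) ^ 2 ≤ (x ^ 2 + 1) ^ 2 := by nlinarith [sq_nonneg x]
    have h4 : (x ^ 2 - 1) ^ 2 ≤ 64 * κ ^ 2 * (2 * Real.exp (τ * (x ^ 2 + 1))) := by
      have : 64 * (κ : ℝ) ^ 2 * (τ * (x ^ 2 + 1)) ^ 2 = (x ^ 2 + 1) ^ 2 := by
        calc 64 * (κ : ℝ) ^ 2 * (τ * (x ^ 2 + 1)) ^ 2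
            = 64 * (τ * κ) ^ 2 * (x ^ 2 + 1) ^ 2 := by ring
          _ = _ := by rw [hτκ]; ring
      calc (x ^ 2 - 1) ^ 2 ≤ 64 * (κ : ℝ) ^ 2 * (τ * (x ^ 2 + 1)) ^ 2 := by rw [this]; exact h3
        _ ≤ _ := by gcongr
    have h5 : Real.exp (2 * τ) ≤ 2 := by
      have hle : 2 * τ ≤ 1 / 2 := by nlinarith
      have h6 := Real.exp_bound_div_one_sub_of_interval (x := 2 * τ) (by positivity) (by linarith)
      refine h6.trans ?_
      rw [div_le_iff₀ (by linarith)]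
      linarith
    calc (t * (x ^ 2 - 1)) ^ 2 * Real.exp |t * (x ^ 2 - 1)|
        ≤ (t ^ 2 * (64 * κ ^ 2 * (2 * Real.exp (τ * (x ^ 2 + 1))))) *
          Real.exp (τ * (x ^ 2 + 1)) := by
          rw [mul_pow]; gcongr
      _ = 128 * κ ^ 2 * t ^ 2 * (Real.exp (2 * τ) * Real.exp (2 * τ * x ^ 2)) := by
          rw [← Real.exp_add, show 2 * τ + 2 * τ * x ^ 2 = τ * (x ^ 2 + 1) + τ * (x ^ 2 + 1) by
            ring, Real.exp_add]
          ring
      _ ≤ 128 * κ ^ 2 * t ^ 2 * (2 * Real.exp (2 * τ * x ^ 2)) := by gcongr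
      _ = _ := by ring
  have hint1 : Integrable (fun ω => 1 + t * (X ω ^ 2 - 1)) μ :=
    (integrable_const _).add ((hsqi.sub (integrable_const _)).const_mul _)
  have hint2 : Integrable (fun ω => 1 + t * (X ω ^ 2 - 1)
      + 256 * κ ^ 2 * t ^ 2 * Real.exp (2 * τ * X ω ^ 2)) μ := hint1.add (hint.const_mul _)
  calc ∫⁻ ω, ENNReal.ofReal (Real.exp (t * (X ω ^ 2 - 1))) ∂μ
      ≤ ∫⁻ ω, ENNReal.ofReal (1 + t * (X ω ^ 2 - 1)
        + 256 * κ ^ 2 * t ^ 2 * Real.exp (2 * τ * X ω ^ 2)) ∂μ :=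
        lintegral_mono fun ω => ENNReal.ofReal_le_ofReal (key _)
    _ = ENNReal.ofReal (∫ ω, (1 + t * (X ω ^ 2 - 1)
        + 256 * κ ^ 2 * t ^ 2 * Real.exp (2 * τ * X ω ^ 2)) ∂μ) := by
        rw [ofReal_integral_eq_lintegral_ofReal hint2
          (ae_of_all _ fun ω => (Real.exp_pos _).le.trans (key _))]
    _ ≤ _ := by
        refine ENNReal.ofReal_le_ofReal ?_
        rw [integral_add hint1 (hint.const_mul _), integral_const_mul,
          integral_add (f := fun _ => 1) (g := fun ω => t * (X ω ^ 2 - 1)) (integrable_const _)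
            ((hsqi.sub (integrable_const _)).const_mul _),
          integral_const_mul, integral_sub hsqi (integrable_const _), hsq]
        simp only [integral_const, probReal_univ, smul_eq_mul, mul_one, sub_self, mul_zero,
          add_zero]
        have h7 : 256 * (κ : ℝ) ^ 2 * t ^ 2 * ∫ ω, Real.exp (2 * τ * X ω ^ 2) ∂μ
            ≤ 256 * κ ^ 2 * t ^ 2 * (3 / 2) := by gcongr
        linarith [Real.add_one_le_exp (384 * (κ : ℝ) ^ 2 * t ^ 2)]

/-! ### Exponential supermartingales and sums of squares -/

/-- An exponential supermartingale bound. The `i`-th increment depends on `X i` and on a linear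
combination of the earlier variables; if its conditional exponential moment is at most `1`, so is
the exponential moment of the sum. -/
lemma lintegral_exp_sum_le_one {Ω ι : Type*} [MeasurableSpace Ω] {μ : Measure Ω}
    [IsProbabilityMeasure μ] [LinearOrder ι] {X : ι → Ω → ℝ} (hm : ∀ i, Measurable (X i))
    (hX : iIndepFun X μ) (b : ι → ι → ℝ) (φ : ι → ℝ → ℝ → ℝ)
    (hφ : ∀ i, Measurable (Function.uncurry (φ i)))
    (h : ∀ i c, ∫⁻ ω, ENNReal.ofReal (Real.exp (φ i (X i ω) c)) ∂μ ≤ 1) (s : Finset ι) :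
    ∫⁻ ω, ENNReal.ofReal (Real.exp (∑ i ∈ s, φ i (X i ω) (∑ j ∈ s with j < i, b i j * X j ω))) ∂μ
      ≤ 1 := by
  induction s using Finset.induction_on_max with
  | empty => simp
  | insert a s has ih =>
    have ha : a ∉ s := fun h => (has a h).false
    set ext : (s → ℝ) → ι → ℝ := fun y i => if hi : i ∈ s then y ⟨i, hi⟩ else 0 with hext
    have hextm : ∀ i, Measurable fun y => ext y i := by
      intro i
      by_cases hi : i ∈ s
      · simpa [hext, hi] using measurable_pi_apply _
      · simp [hext, hi]
    set Y : Ω → s → ℝ := fun ω i => X i ω with hY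
    have hYm : Measurable Y := measurable_pi_lambda _ fun i => hm i
    have hextY : ∀ ω, ∀ i ∈ s, ext (Y ω) i = X i ω := by
      intro ω i hi
      simp [hext, hY, hi]
    set g : (s → ℝ) → ℝ := fun y =>
      ∑ i ∈ s, φ i (ext y i) (∑ j ∈ s with j < i, b i j * ext y j) with hg
    set c : (s → ℝ) → ℝ := fun y => ∑ j ∈ s, b a j * ext y j with hc
    have hcm : Measurable c := by fun_prop
    have hgm : Measurable g := by
      refine Finset.measurable_sum _ fun i _ => ?_
      have h2 : Measurable fun y => (ext y i, ∑ j ∈ s with j < i, b i j * ext y j) := by fun_prop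
      exact (hφ i).comp h2
    have hsplit : ∀ ω, (∑ i ∈ insert a s,
        φ i (X i ω) (∑ j ∈ insert a s with j < i, b i j * X j ω))
        = g (Y ω) + φ a (X a ω) (c (Y ω)) := by
      intro ω
      rw [Finset.sum_insert ha, add_comm]
      congr 1
      · refine Finset.sum_congr rfl fun i hi => ?_
        rw [hextY ω i hi, Finset.filter_insert, if_neg (has i hi).not_gt]
        congr 1
        refine Finset.sum_congr rfl fun j hj => ?_
        rw [hextY ω j (Finset.mem_filter.1 hj).1]
      · rw [Finset.filter_insert, if_neg (lt_irrefl a), Finset.filter_true_of_mem has]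
        congr 1
        refine Finset.sum_congr rfl fun j hj => ?_
        rw [hextY ω j hj]
    have hind : IndepFun Y (X a) μ :=
      (hX.indepFun_finset s {a} (Finset.disjoint_singleton_right.2 ha) hm).comp measurable_id
        (measurable_pi_apply (⟨a, Finset.mem_singleton_self a⟩ : ({a} : Finset ι)))
    set F : (s → ℝ) × ℝ → ENNReal := fun z =>
      ENNReal.ofReal (Real.exp (g z.1)) * ENNReal.ofReal (Real.exp (φ a z.2 (c z.1))) with hF
    have hφm : Measurable fun z : (s → ℝ) × ℝ => φ a z.2 (c z.1) := by
      have h2 : Measurable fun z : (s → ℝ) × ℝ => (z.2, c z.1) := by fun_prop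
      exact (hφ a).comp h2
    have hFm : Measurable F := by fun_prop
    have hpm : ∀ y, Measurable fun x => φ a x (c y) := fun y => hφm.comp (by fun_prop :
      Measurable fun x : ℝ => (y, x))
    have : IsProbabilityMeasure (μ.map (X a)) := Measure.isProbabilityMeasure_map
      (hm a).aemeasurable
    calc _ = ∫⁻ ω, F (Y ω, X a ω) ∂μ := by
          refine lintegral_congr fun ω => ?_
          rw [hsplit, Real.exp_add, ENNReal.ofReal_mul (Real.exp_pos _).le]
      _ = ∫⁻ z, F z ∂(μ.map Y).prod (μ.map (X a)) := by
          rw [← (indepFun_iff_map_prod_eq_prod_map_map hYm.aemeasurable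
            (hm a).aemeasurable).1 hind, lintegral_map hFm (hYm.prodMk (hm a))]
      _ = ∫⁻ y, ∫⁻ x, F (y, x) ∂μ.map (X a) ∂μ.map Y := lintegral_prod _ hFm.aemeasurable
      _ ≤ ∫⁻ y, ENNReal.ofReal (Real.exp (g y)) ∂μ.map Y := by
          refine lintegral_mono fun y => ?_
          have := hpm y
          simp only [hF]
          rw [lintegral_const_mul _ (by fun_prop), lintegral_map (by fun_prop) (hm a)]
          exact mul_le_of_le_one_right' (h a (c y))
      _ = ∫⁻ ω, ENNReal.ofReal (Real.exp (g (Y ω))) ∂μ := lintegral_map (by fun_prop) hYm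
      _ ≤ 1 := by
          refine le_trans (lintegral_mono fun ω => le_of_eq ?_) ih
          congr 2
          refine Finset.sum_congr rfl fun i hi => ?_
          rw [hextY ω i hi]
          congr 1
          refine Finset.sum_congr rfl fun j hj => ?_
          rw [hextY ω j (Finset.mem_filter.1 hj).1]

/-- Sums of squares of sub-Gaussian variables, which may be dependent. By convexity of `exp`, the
sum `∑ᵢ Yᵢ²` is treated as an average of the variables `Yᵢ²` normalised by their parameters. -/
lemma lintegral_exp_mul_sum_sq_le {Ω ι : Type*} [MeasurableSpace Ω] {μ : Measure Ω}
    [IsProbabilityMeasure μ] [Fintype ι] {Y : ι → Ω → ℝ} (hm : ∀ i, Measurable (Y i))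
    {p : ι → ℝ≥0} (hY : ∀ i, HasSubgaussianMGF (Y i) (p i) μ) {u : ℝ} (hu : 0 ≤ u)
    (hup : u * ∑ i, (p i : ℝ) ≤ 1 / 4) :
    ∫⁻ ω, ENNReal.ofReal (Real.exp (u * ∑ i, Y i ω ^ 2)) ∂μ
      ≤ ENNReal.ofReal (Real.exp (2 * (u * ∑ i, (p i : ℝ)))) := by
  set P : ℝ := ∑ i, (p i : ℝ) with hP
  have hP0 : 0 ≤ P := Finset.sum_nonneg fun i _ => (p i).2
  -- A variable with parameter `0` vanishes almost surely.
  have hzero : ∀ᵐ ω ∂μ, ∀ i, p i = 0 → Y i ω = 0 := by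
    rw [ae_all_iff]
    intro i
    by_cases hi : p i = 0
    · have h0 := hY i
      rw [hi] at h0
      filter_upwards [h0.ae_eq_zero_of_hasSubgaussianMGF_zero] with ω hω _
      exact hω
    · exact ae_of_all _ fun ω h => absurd h hi
  rcases hP0.eq_or_lt with hP0 | hPpos
  · have hp0 : ∀ i, p i = 0 := by
      intro i
      have := (Finset.sum_eq_zero_iff_of_nonneg fun i _ => (p i).2).1 (hP ▸ hP0.symm) i
        (Finset.mem_univ i)
      exact NNReal.coe_eq_zero.1 this
    rw [← hP0, lintegral_congr_ae (g := fun _ => 1)]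
    · simp
    · filter_upwards [hzero] with ω hω
      simp [hω _ (hp0 _)]
  set w : ι → ℝ := fun i => p i / P with hw
  have hw0 : ∀ i, 0 ≤ w i := fun i => by positivity
  have hw1 : ∑ i, w i = 1 := by
    rw [hw, ← Finset.sum_div, ← hP, div_self hPpos.ne']
  have key : ∀ᵐ ω ∂μ, Real.exp (u * ∑ i, Y i ω ^ 2)
      ≤ ∑ i, w i * Real.exp (u / w i * Y i ω ^ 2) := by
    filter_upwards [hzero] with ω hω
    have h1 : u * ∑ i, Y i ω ^ 2 = ∑ i, w i • (u / w i * Y i ω ^ 2) := by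
      rw [Finset.mul_sum]
      refine Finset.sum_congr rfl fun i _ => ?_
      by_cases hi : p i = 0
      · simp [hω i hi]
      · have : w i ≠ 0 := by simp [hw, hi, hPpos.ne']
        rw [smul_eq_mul]
        field_simp
    rw [h1]
    exact convexOn_exp.map_sum_le (fun i _ => hw0 i) hw1 fun i _ => Set.mem_univ _
  have hterm : ∀ i, ENNReal.ofReal (w i) *
      ∫⁻ ω, ENNReal.ofReal (Real.exp (u / w i * Y i ω ^ 2)) ∂μ
      ≤ ENNReal.ofReal (w i * (1 + 2 * (u * P))) := by
    intro i
    rw [ENNReal.ofReal_mul (hw0 i)]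
    by_cases hi : p i = 0
    · simp [hw, hi]
    · have hpi : (p i : ℝ) ≠ 0 := by exact_mod_cast hi
      have h1 : u / w i * p i = u * P := by
        simp only [hw]
        field_simp
      have := lintegral_exp_mul_sq_le_of_hasSubgaussianMGF (hm i) (hY i) (u := u / w i)
        (div_nonneg hu (hw0 i)) (by rw [h1]; exact hup)
      rw [h1] at this
      gcongr
  calc ∫⁻ ω, ENNReal.ofReal (Real.exp (u * ∑ i, Y i ω ^ 2)) ∂μ
      ≤ ∫⁻ ω, ∑ i, ENNReal.ofReal (w i) *
        ENNReal.ofReal (Real.exp (u / w i * Y i ω ^ 2)) ∂μ := by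
        refine lintegral_mono_ae ?_
        filter_upwards [key] with ω hω
        refine (ENNReal.ofReal_le_ofReal hω).trans ?_
        rw [ENNReal.ofReal_sum_of_nonneg fun i _ => mul_nonneg (hw0 i) (Real.exp_pos _).le]
        exact Finset.sum_le_sum fun i _ => (ENNReal.ofReal_mul (hw0 i)).le
    _ = ∑ i, ENNReal.ofReal (w i) *
        ∫⁻ ω, ENNReal.ofReal (Real.exp (u / w i * Y i ω ^ 2)) ∂μ := by
        rw [lintegral_finsetSum _ fun i _ => by have := hm i; fun_prop]
        exact Finset.sum_congr rfl fun i _ => lintegral_const_mul _ (by have := hm i; fun_prop)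
    _ ≤ ∑ i, ENNReal.ofReal (w i * (1 + 2 * (u * P))) := Finset.sum_le_sum fun i _ => hterm i
    _ = ENNReal.ofReal (1 + 2 * (u * P)) := by
        rw [← ENNReal.ofReal_sum_of_nonneg fun i _ => mul_nonneg (hw0 i) (by positivity),
          ← Finset.sum_mul, hw1, one_mul]
    _ ≤ _ := ENNReal.ofReal_le_ofReal (by linarith [Real.add_one_le_exp (2 * (u * P))])

/-! ### Best low-rank approximation -/

lemma sq_frobenius_norm {m n : Type*} [Fintype m] [Fintype n] (M : Matrix m n ℝ) :
    ‖M‖ ^ 2 = ∑ i, ∑ j, M i j ^ 2 := by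
  rw [Matrix.frobenius_norm_def, ← Real.sqrt_eq_rpow, Real.sq_sqrt (by positivity)]
  simp

lemma sq_frobenius_norm_eq_trace {m n : Type*} [Fintype m] [Fintype n] (M : Matrix m n ℝ) :
    ‖M‖ ^ 2 = (M * Mᵀ).trace := by
  rw [sq_frobenius_norm]
  simp [Matrix.trace, Matrix.mul_apply, pow_two]

/-- The best rank-`k` approximation of a positive semidefinite `A` satisfies
`‖A - Aₖ‖_F ≤ tr A / √k`. The competitor keeps the eigenvalues above `tr A / k`, of which there are
at most `k`; each remaining eigenvalue is at most `tr A / k`, so their squares sum to at most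
`(tr A)² / k`. -/
lemma IsBestRankApprox.sq_norm_sub_mul_le {d k : ℕ} {A Ak : Matrix (Fin d) (Fin d) ℝ}
    (h : IsBestRankApprox k A Ak) (hA : A.PosSemidef) (hk : 1 ≤ k) :
    ‖A - Ak‖ ^ 2 * k ≤ A.trace ^ 2 := by
  set e := hA.1.eigenvalues with he
  have he0 : ∀ i, 0 ≤ e i := hA.eigenvalues_nonneg
  have htr : A.trace = ∑ i, e i := by
    have := hA.1.trace_eq_sum_eigenvalues
    simpa using this
  have hkpos : (0 : ℝ) < k := by exact_mod_cast hk
  set U : Matrix (Fin d) (Fin d) ℝ := hA.1.eigenvectorUnitary.1 with hU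
  have hUU : Uᵀ * U = 1 := by
    have := Unitary.coe_star_mul_self hA.1.eigenvectorUnitary
    simpa [Matrix.star_eq_conjTranspose] using this
  have hAU : A = U * Matrix.diagonal e * Uᵀ := by
    have := hA.1.spectral_theorem
    rw [Unitary.conjStarAlgAut_apply] at this
    simpa [Matrix.star_eq_conjTranspose, Function.comp_def] using this
  set S : Finset (Fin d) := Finset.univ.filter fun i => A.trace < k * e i with hS
  set f : Fin d → ℝ := fun i => if i ∈ S then e i else 0 with hf
  have hcard : S.card ≤ k := by
    by_contra hlt
    push Not at hlt
    have h2 : ∑ i ∈ S, e i ≤ A.trace := by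
      rw [htr]
      exact Finset.sum_le_univ_sum_of_nonneg he0
    have hne : S.Nonempty := Finset.card_pos.1 (by omega)
    have h1 : ∑ _i ∈ S, A.trace < ∑ i ∈ S, k * e i :=
      Finset.sum_lt_sum_of_nonempty hne fun i hi => (Finset.mem_filter.1 hi).2
    rw [Finset.sum_const, nsmul_eq_mul, ← Finset.mul_sum] at h1
    have h3 : (k : ℝ) ≤ S.card := by exact_mod_cast hlt.le
    have h4 : 0 ≤ A.trace := hA.trace_nonneg
    nlinarith
  set B : Matrix (Fin d) (Fin d) ℝ := U * Matrix.diagonal f * Uᵀ with hB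
  have hrank : B.rank ≤ k := by
    calc B.rank ≤ (U * Matrix.diagonal f).rank := Matrix.rank_mul_le_left _ _
      _ ≤ (Matrix.diagonal f).rank := Matrix.rank_mul_le_right _ _
      _ = Fintype.card {i // f i ≠ 0} := Matrix.rank_diagonal _
      _ ≤ S.card := by
        rw [Fintype.card_subtype]
        refine Finset.card_le_card fun i hi => ?_
        by_contra hiS
        simp [hf, hiS] at hi
      _ ≤ k := hcard
  have hdiff : A - B = U * Matrix.diagonal (fun i => e i - f i) * Uᵀ := by
    rw [hB]
    nth_rewrite 1 [hAU]
    rw [← sub_mul, ← mul_sub, Matrix.diagonal_sub]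
  have hnorm : ‖A - B‖ ^ 2 = ∑ i, (e i - f i) ^ 2 := by
    rw [sq_frobenius_norm_eq_trace, hdiff, Matrix.transpose_mul, Matrix.transpose_mul,
      Matrix.transpose_transpose, Matrix.diagonal_transpose]
    set D := Matrix.diagonal fun i => e i - f i with hD
    calc (U * D * Uᵀ * (U * (D * Uᵀ))).trace
        = (U * (D * (Uᵀ * U) * D) * Uᵀ).trace := by simp only [Matrix.mul_assoc]
      _ = (Uᵀ * U * (D * D)).trace := by
        rw [hUU, Matrix.mul_one, Matrix.trace_mul_comm, ← Matrix.mul_assoc, hUU]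
      _ = _ := by
        rw [hUU, Matrix.one_mul, hD, Matrix.diagonal_mul_diagonal, Matrix.trace_diagonal]
        simp [pow_two]
  have hle : ‖A - Ak‖ ^ 2 ≤ ‖A - B‖ ^ 2 := pow_le_pow_left₀ (norm_nonneg _) (h.2 B hrank) 2
  calc ‖A - Ak‖ ^ 2 * k ≤ ‖A - B‖ ^ 2 * k := by gcongr
    _ = ∑ i, k * (e i - f i) ^ 2 := by rw [hnorm, mul_comm, Finset.mul_sum]
    _ ≤ ∑ i, A.trace * e i := by
      refine Finset.sum_le_sum fun i _ => ?_
      by_cases hi : i ∈ S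
      · simpa [hf, hi] using mul_nonneg hA.trace_nonneg (he0 i)
      · have : k * e i ≤ A.trace := by simpa [hS] using hi
        simp only [hf, hi, if_false, sub_zero]
        nlinarith [he0 i]
    _ = A.trace ^ 2 := by rw [← Finset.mul_sum, ← htr, pow_two]

/-! ### The Hanson–Wright inequality with the Frobenius norm -/

lemma sum_sum_eq_sum_add_sum_lt {ι : Type*} [Fintype ι] [LinearOrder ι] (f : ι → ι → ℝ) :
    ∑ i, ∑ j, f i j = ∑ i, (f i i + ∑ j with j < i, (f i j + f j i)) := by
  have h1 : ∀ i, ∑ j, f i j = f i i + ((∑ j, if j < i then f i j else 0)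
      + ∑ j, if i < j then f i j else 0) := by
    intro i
    have h2 : f i i = ∑ j, if j = i then f i j else 0 := by simp
    rw [h2, ← Finset.sum_add_distrib, ← Finset.sum_add_distrib]
    refine Finset.sum_congr rfl fun j _ => ?_
    rcases lt_trichotomy j i with h | h | h
    · simp [h, h.ne, h.not_gt]
    · simp [h]
    · simp [h, h.ne', h.not_gt]
  simp_rw [h1, Finset.sum_filter, ite_add_zero, Finset.sum_add_distrib]
  rw [Finset.sum_comm (f := fun i j => if i < j then f i j else 0)]

/-- Exponential moments of a centred quadratic form in independent sub-Gaussian variables, in the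
range of parameters allowed by the Frobenius norm. Ordering the variables writes the form as a sum
of martingale increments `Dᵢᵢ (Xᵢ² - 1) + Xᵢ cᵢ` with `cᵢ` a linear combination of the earlier
variables. Subtracting a multiple of `∑ᵢ cᵢ²` gives an exponential supermartingale, and `∑ᵢ cᵢ²` is
itself a sum of squares of sub-Gaussian variables. -/
lemma lintegral_exp_quadratic_form_le {Ω ι : Type*} [MeasurableSpace Ω] {μ : Measure Ω}
    [IsProbabilityMeasure μ] [Fintype ι] [LinearOrder ι] {X : ι → Ω → ℝ}
    (hm : ∀ i, Measurable (X i)) (hX : iIndepFun X μ) {κ : ℝ≥0} (hκ : 1 ≤ κ)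
    (hsub : ∀ i, HasSubgaussianMGF (X i) κ μ) (hsq : ∀ i, ∫ ω, X i ω ^ 2 ∂μ = 1)
    (D : Matrix ι ι ℝ) {t : ℝ} (ht : (32 * κ * t) ^ 2 * ‖D‖ ^ 2 ≤ 1) :
    ∫⁻ ω, ENNReal.ofReal (Real.exp
        (t * ((fun i => X i ω) ⬝ᵥ (D *ᵥ fun i => X i ω) - D.trace))) ∂μ
      ≤ ENNReal.ofReal (Real.exp (1544 * κ ^ 2 * t ^ 2 * ‖D‖ ^ 2)) := by
  have hN : ‖D‖ ^ 2 = ∑ i, ∑ j, D i j ^ 2 := sq_frobenius_norm D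
  set N : ℝ := ‖D‖ ^ 2 with hNdef
  set b : ι → ι → ℝ := fun i j => D i j + D j i with hb
  set c : ι → Ω → ℝ := fun i ω => ∑ j with j < i, b i j * X j ω with hc
  have hcm : ∀ i, Measurable (c i) := fun i => by fun_prop
  have hsplitN := sum_sum_eq_sum_add_sum_lt fun i j => D i j ^ 2
  rw [← hN] at hsplitN
  have hdiagN : ∑ i, D i i ^ 2 ≤ N := by
    rw [hsplitN]
    exact Finset.sum_le_sum fun i _ => le_add_of_nonneg_right (by positivity)
  have hbN : ∑ i, ∑ j with j < i, b i j ^ 2 ≤ 2 * N := by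
    rw [hsplitN, Finset.mul_sum]
    refine Finset.sum_le_sum fun i _ => ?_
    have : ∑ j with j < i, b i j ^ 2 ≤ 2 * ∑ j with j < i, (D i j ^ 2 + D j i ^ 2) := by
      rw [Finset.mul_sum]
      refine Finset.sum_le_sum fun j _ => ?_
      simp only [hb]
      nlinarith [sq_nonneg (D i j - D j i)]
    nlinarith [sq_nonneg (D i i)]
  have hform : ∀ ω, (fun i => X i ω) ⬝ᵥ (D *ᵥ fun i => X i ω) - D.trace
      = ∑ i, (D i i * (X i ω ^ 2 - 1) + X i ω * c i ω) := by
    intro ω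
    have h1 : (fun i => X i ω) ⬝ᵥ (D *ᵥ fun i => X i ω) = ∑ i, ∑ j, X i ω * D i j * X j ω := by
      simp only [dotProduct, Matrix.mulVec, Finset.mul_sum, mul_assoc]
    rw [h1, sum_sum_eq_sum_add_sum_lt, Matrix.trace, ← Finset.sum_sub_distrib]
    refine Finset.sum_congr rfl fun i _ => ?_
    have h2 : X i ω * c i ω
        = ∑ j with j < i, (X i ω * D i j * X j ω + X j ω * D j i * X i ω) := by
      simp only [hc, hb, Finset.mul_sum]
      exact Finset.sum_congr rfl fun j _ => by ring
    rw [← h2, Matrix.diag_apply]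
    ring
  -- The supermartingale increments.
  set φ : ι → ℝ → ℝ → ℝ := fun i x y => 2 * t * (D i i * (x ^ 2 - 1) + x * y)
    - (4 * κ * t ^ 2 * y ^ 2 + 3072 * κ ^ 2 * t ^ 2 * D i i ^ 2) with hφ
  have hφ1 : ∀ i y, ∫⁻ ω, ENNReal.ofReal (Real.exp (φ i (X i ω) y)) ∂μ ≤ 1 := by
    intro i y
    have hi := hm i
    have hDi : (32 * κ * t * D i i) ^ 2 ≤ 1 := by
      have : D i i ^ 2 ≤ N := (Finset.single_le_sum (f := fun i => D i i ^ 2)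
        (fun i _ => sq_nonneg _) (Finset.mem_univ i)).trans hdiagN
      calc (32 * κ * t * D i i) ^ 2 = (32 * κ * t) ^ 2 * D i i ^ 2 := by ring
        _ ≤ (32 * κ * t) ^ 2 * N := by gcongr
        _ ≤ 1 := ht
    have h1 := lintegral_exp_mul_sq_sub_one_le hi hκ (hsub i) (hsq i) (t := 4 * t * D i i) (by
      have := (sq_le_one_iff_abs_le_one _).1 hDi
      calc |4 * t * D i i| * (8 * κ) = |32 * κ * t * D i i| := by
            rw [show 32 * (κ : ℝ) * t * D i i = 4 * t * D i i * (8 * κ) by ring,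
              abs_mul (4 * t * D i i), abs_of_nonneg (by positivity : (0 : ℝ) ≤ 8 * κ)]
        _ ≤ 1 := this)
    have h2 := lintegral_exp_mul_le_of_hasSubgaussianMGF (hsub i) (4 * t * y)
    have h3 := lintegral_exp_add_le (μ := μ) (f := fun ω => 2 * t * D i i * (X i ω ^ 2 - 1))
      (g := fun ω => 2 * t * y * X i ω) (a := 3072 * κ ^ 2 * t ^ 2 * D i i ^ 2)
      (b := 4 * κ * t ^ 2 * y ^ 2) (by fun_prop) (by fun_prop)
      (by convert h1 using 3 <;> ring_nf) (by convert h2 using 3 <;> ring_nf)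
    have h4 : ∀ ω, ENNReal.ofReal (Real.exp (φ i (X i ω) y))
        = ENNReal.ofReal (Real.exp
            (-(3072 * κ ^ 2 * t ^ 2 * D i i ^ 2 + 4 * κ * t ^ 2 * y ^ 2)))
          * ENNReal.ofReal (Real.exp
            (2 * t * D i i * (X i ω ^ 2 - 1) + 2 * t * y * X i ω)) := by
      intro ω
      rw [← ENNReal.ofReal_mul (Real.exp_pos _).le, ← Real.exp_add]
      congr 2
      simp only [hφ]
      ring
    simp_rw [h4]
    rw [lintegral_const_mul _ (by fun_prop)]
    refine (mul_le_mul_right h3 _).trans ?_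
    rw [← ENNReal.ofReal_mul (Real.exp_pos _).le, ← Real.exp_add, neg_add_cancel]
    simp
  have hsup := lintegral_exp_sum_le_one hm hX b φ (fun i => by
    simp only [hφ, Function.uncurry_def]; fun_prop) hφ1 Finset.univ
  -- The sub-Gaussian parameters of the linear forms `c i`.
  set p : ι → ℝ≥0 := fun i => ∑ j with j < i, ⟨b i j ^ 2, sq_nonneg _⟩ * κ with hp
  have hcsub : ∀ i, HasSubgaussianMGF (c i) (p i) μ := fun i =>
    HasSubgaussianMGF.sum_of_iIndepFun (X := fun j ω => b i j * X j ω)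
      (hX.comp (fun j x => b i j * x) fun j => by fun_prop)
      (c := fun j => ⟨b i j ^ 2, sq_nonneg _⟩ * κ) fun j _ => (hsub j).const_mul _
  have hpN : ∑ i, (p i : ℝ) ≤ 2 * κ * N := by
    have : ∑ i, (p i : ℝ) = κ * ∑ i, ∑ j with j < i, b i j ^ 2 := by
      rw [Finset.mul_sum]
      refine Finset.sum_congr rfl fun i _ => ?_
      simp only [hp, NNReal.coe_sum, Finset.mul_sum]
      exact Finset.sum_congr rfl fun j _ => mul_comm _ _
    rw [this]
    nlinarith
  have hsqs := lintegral_exp_mul_sum_sq_le hcm hcsub (u := 4 * κ * t ^ 2) (by positivity) (by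
    calc 4 * κ * t ^ 2 * ∑ i, (p i : ℝ) ≤ 4 * κ * t ^ 2 * (2 * κ * N) := by gcongr
      _ = (32 * κ * t) ^ 2 * N / 128 := by ring
      _ ≤ 1 / 4 := by linarith)
  have hfin := lintegral_exp_add_le (μ := μ)
    (f := fun ω => 1 / 2 * ∑ i, φ i (X i ω) (c i ω))
    (g := fun ω => 1 / 2 * (4 * κ * t ^ 2 * ∑ i, c i ω ^ 2)) (a := 0)
    (b := 1 / 2 * (16 * κ ^ 2 * t ^ 2 * N)) (by simp only [hφ]; fun_prop) (by fun_prop)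
    (by simpa using hsup) (by
      simp only [← mul_assoc, mul_one_div_cancel (two_ne_zero (α := ℝ)), one_mul] at hsqs ⊢
      refine hsqs.trans (ENNReal.ofReal_le_ofReal (Real.exp_le_exp.2 ?_))
      calc 2 * 4 * κ * t ^ 2 * ∑ i, (p i : ℝ) ≤ 2 * 4 * κ * t ^ 2 * (2 * κ * N) := by gcongr
        _ = _ := by ring)
  have hpt : ∀ ω, t * ((fun i => X i ω) ⬝ᵥ (D *ᵥ fun i => X i ω) - D.trace)
      = 1536 * κ ^ 2 * t ^ 2 * ∑ i, D i i ^ 2 + (1 / 2 * ∑ i, φ i (X i ω) (c i ω)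
        + 1 / 2 * (4 * κ * t ^ 2 * ∑ i, c i ω ^ 2)) := by
    intro ω
    rw [hform]
    simp only [hφ, Finset.mul_sum, ← Finset.sum_add_distrib]
    exact Finset.sum_congr rfl fun i _ => by ring
  simp_rw [hpt, Real.exp_add (1536 * _ * _ * _), ENNReal.ofReal_mul (Real.exp_pos _).le]
  rw [lintegral_const_mul _ (by simp only [hφ]; fun_prop)]
  refine (mul_le_mul_right hfin _).trans ?_
  rw [← ENNReal.ofReal_mul (Real.exp_pos _).le, ← Real.exp_add]
  refine ENNReal.ofReal_le_ofReal (Real.exp_le_exp.2 ?_)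
  have : 1536 * (κ : ℝ) ^ 2 * t ^ 2 * ∑ i, D i i ^ 2 ≤ 1536 * κ ^ 2 * t ^ 2 * N := by gcongr
  linarith

/-! ### Concentration of Hutchinson's estimator -/

/-- The columns of a random matrix with independent entries are independent. -/
lemma lintegral_prod_columns {Ω α β : Type*} [MeasurableSpace Ω] {μ : Measure Ω}
    [Fintype α] {X : α × β → Ω → ℝ} (hm : ∀ p, Measurable (X p)) (hX : iIndepFun X μ)
    {F : (α → ℝ) → ENNReal} (hF : Measurable F) (s : Finset β) :
    ∫⁻ ω, ∏ i ∈ s, F (fun a => X (a, i) ω) ∂μ = ∏ i ∈ s, ∫⁻ ω, F (fun a => X (a, i) ω) ∂μ := by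
  classical
  have : IsProbabilityMeasure μ := hX.isProbabilityMeasure
  have hcol : ∀ i, Measurable fun ω => F fun a => X (a, i) ω := fun i =>
    hF.comp (measurable_pi_lambda _ fun a => hm (a, i))
  induction s using Finset.induction_on with
  | empty => simp
  | insert k s hk ih =>
    simp_rw [Finset.prod_insert hk]
    rw [← ih]
    refine lintegral_mul_eq_lintegral_mul_lintegral_of_indepFun (hcol k)
      (Finset.measurable_prod _ fun i _ => hcol i) ?_
    set S : Finset (α × β) := Finset.univ ×ˢ {k} with hS
    set T : Finset (α × β) := Finset.univ ×ˢ s with hT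
    have hST : Disjoint S T := Finset.disjoint_product.2
      (Or.inr (Finset.disjoint_singleton_left.2 hk))
    set extS : (S → ℝ) → α × β → ℝ := fun y p => if hp : p ∈ S then y ⟨p, hp⟩ else 0 with hextS
    set extT : (T → ℝ) → α × β → ℝ := fun y p => if hp : p ∈ T then y ⟨p, hp⟩ else 0 with hextT
    have hextSm : ∀ p, Measurable fun y => extS y p := by
      intro p
      by_cases hp : p ∈ S
      · simpa [hextS, hp] using measurable_pi_apply _
      · simp [hextS, hp]
    have hextTm : ∀ p, Measurable fun y => extT y p := by
      intro p
      by_cases hp : p ∈ T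
      · simpa [hextT, hp] using measurable_pi_apply _
      · simp [hextT, hp]
    have h := (hX.indepFun_finset S T hST hm).comp
      (φ := fun y => F fun a => extS y (a, k)) (ψ := fun y => ∏ i ∈ s, F fun a => extT y (a, i))
      (hF.comp (measurable_pi_lambda _ fun a => hextSm (a, k)))
      (Finset.measurable_prod _ fun i _ =>
        hF.comp (measurable_pi_lambda _ fun a => hextTm (a, i)))
    convert h using 1
    · ext ω
      simp [hextS, hS]
    · ext ω
      refine Finset.prod_congr rfl fun i hi => ?_
      simp [hextT, hT, hi]

lemma IsSubgaussianQueryMatrix.mono {Ω : Type*} [MeasurableSpace Ω] {μ : Measure Ω} {d ℓ : ℕ}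
    {K κ : ℝ≥0} {G : Ω → Matrix (Fin d) (Fin ℓ) ℝ} (hG : IsSubgaussianQueryMatrix K G μ)
    (h : K ≤ κ) : IsSubgaussianQueryMatrix κ G μ where
  measurable := hG.measurable
  indep := hG.indep
  identDistrib := hG.identDistrib
  mean_zero := hG.mean_zero
  variance_one := hG.variance_one
  subgaussian i j := by
    refine ⟨(hG.subgaussian i j).integrable_exp_mul, fun t => ?_⟩
    refine ((hG.subgaussian i j).mgf_le t).trans (Real.exp_le_exp.2 ?_)
    have : (K : ℝ) ≤ κ := h
    gcongr

lemma IsSubgaussianQueryMatrix.integral_sq {Ω : Type*} [MeasurableSpace Ω] {μ : Measure Ω}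
    [IsProbabilityMeasure μ] {d ℓ : ℕ} {K : ℝ≥0} {G : Ω → Matrix (Fin d) (Fin ℓ) ℝ}
    (hG : IsSubgaussianQueryMatrix K G μ) (i : Fin d) (j : Fin ℓ) :
    ∫ ω, G ω i j ^ 2 ∂μ = 1 := by
  have h := variance_of_integral_eq_zero (hG.measurable i j).aemeasurable (hG.mean_zero i j)
  rw [hG.variance_one i j] at h
  exact h.symm

/-- The Chernoff bound for one tail of Hutchinson's estimator, with `x = log (1/δ)`. The rate
`√(x/ℓ)/‖Δ‖` is admissible for the exponential moments as soon as `(32κ)² x ≤ ℓ`. -/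
lemma measure_hutch_sub_trace_gt_le {Ω : Type*} [MeasurableSpace Ω] {μ : Measure Ω}
    [IsProbabilityMeasure μ] {d ℓ : ℕ} {κ : ℝ≥0} (hκ : 1 ≤ κ)
    {G : Ω → Matrix (Fin d) (Fin ℓ) ℝ} (hG : IsSubgaussianQueryMatrix κ G μ)
    (Δ : Matrix (Fin d) (Fin d) ℝ) {x : ℝ} (hx : 0 < x) (hxℓ : (32 * κ) ^ 2 * x ≤ ℓ) :
    μ {ω | (1544 * κ ^ 2 + 2) * ‖Δ‖ * √(x / ℓ) < hutch (G ω) Δ - Δ.trace}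
      ≤ ENNReal.ofReal (Real.exp (-(2 * x))) := by
  have hℓ : (0 : ℝ) < ℓ := lt_of_lt_of_le (by positivity) hxℓ
  set q : Fin ℓ → Ω → ℝ := fun i ω =>
    (fun a => G ω a i) ⬝ᵥ (Δ *ᵥ fun a => G ω a i) - Δ.trace with hq
  have hhutch : ∀ ω, ℓ * (hutch (G ω) Δ - Δ.trace) = ∑ i, q i ω := by
    intro ω
    simp only [hq, hutch, Finset.sum_sub_distrib, Finset.sum_const, Finset.card_univ,
      Fintype.card_fin, nsmul_eq_mul]
    field_simp
  rcases (norm_nonneg Δ).eq_or_lt with h0 | hpos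
  · have hΔ : Δ = 0 := norm_eq_zero.1 h0.symm
    subst hΔ
    simp [hutch]
  set r : ℝ := √(x / ℓ) with hr
  have hr2 : r ^ 2 = x / ℓ := Real.sq_sqrt (by positivity)
  have hrpos : 0 < r := Real.sqrt_pos.2 (by positivity)
  set t : ℝ := r / ‖Δ‖ with ht
  have htpos : 0 < t := by positivity
  have htN : t * ‖Δ‖ = r := by rw [ht]; field_simp
  have hadm : (32 * κ * t) ^ 2 * ‖Δ‖ ^ 2 ≤ 1 := by
    calc (32 * (κ : ℝ) * t) ^ 2 * ‖Δ‖ ^ 2 = (32 * κ) ^ 2 * (t * ‖Δ‖) ^ 2 := by ring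
      _ = (32 * κ) ^ 2 * x / ℓ := by rw [htN, hr2]; ring
      _ ≤ 1 := (div_le_one hℓ).2 hxℓ
  have hcol : ∀ i, ∫⁻ ω, ENNReal.ofReal (Real.exp (t * q i ω)) ∂μ
      ≤ ENNReal.ofReal (Real.exp (1544 * κ ^ 2 * (x / ℓ))) := by
    intro i
    have h := lintegral_exp_quadratic_form_le (X := fun a ω => G ω a i)
      (fun a => hG.measurable a i)
      (hG.indep.precomp (g := fun a => (a, i)) fun a b hab => (Prod.mk.inj hab).1) hκ
      (fun a => hG.subgaussian a i) (fun a => hG.integral_sq a i) Δ hadm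
    rwa [mul_assoc _ (t ^ 2), ← mul_pow, htN, hr2] at h
  set F : (Fin d → ℝ) → ENNReal := fun y =>
    ENNReal.ofReal (Real.exp (t * (y ⬝ᵥ (Δ *ᵥ y) - Δ.trace))) with hF
  have hFm : Measurable F := by
    simp only [hF, dotProduct, Matrix.mulVec]
    fun_prop
  have hsum : ∫⁻ ω, ENNReal.ofReal (Real.exp (t * ∑ i, q i ω)) ∂μ
      ≤ ENNReal.ofReal (Real.exp (1544 * κ ^ 2 * x)) := by
    have h1 := lintegral_prod_columns (X := fun p ω => G ω p.1 p.2)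
      (fun p => hG.measurable p.1 p.2) hG.indep hFm Finset.univ
    calc ∫⁻ ω, ENNReal.ofReal (Real.exp (t * ∑ i, q i ω)) ∂μ
        = ∏ i, ∫⁻ ω, ENNReal.ofReal (Real.exp (t * q i ω)) ∂μ := by
          rw [← h1]
          refine lintegral_congr fun ω => ?_
          rw [Finset.mul_sum, Real.exp_sum,
            ENNReal.ofReal_prod_of_nonneg fun i _ => (Real.exp_pos _).le]
      _ ≤ ∏ _i : Fin ℓ, ENNReal.ofReal (Real.exp (1544 * κ ^ 2 * (x / ℓ))) :=
          Finset.prod_le_prod' fun i _ => hcol i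
      _ = _ := by
          rw [Finset.prod_const, Finset.card_univ, Fintype.card_fin,
            ← ENNReal.ofReal_pow (Real.exp_pos _).le, ← Real.exp_nat_mul]
          congr 2
          field_simp
  have hqm : ∀ i, Measurable (q i) := by
    intro i
    have := fun a => hG.measurable a i
    simp only [hq, dotProduct, Matrix.mulVec]
    fun_prop
  set T : ℝ := 1544 * κ ^ 2 + 2 with hT
  have hsub : {ω | T * ‖Δ‖ * r < hutch (G ω) Δ - Δ.trace}
      ⊆ {ω | ENNReal.ofReal (Real.exp (T * x))
        ≤ ENNReal.ofReal (Real.exp (t * ∑ i, q i ω))} := by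
    intro ω hω
    refine ENNReal.ofReal_le_ofReal (Real.exp_le_exp.2 ?_)
    rw [← hhutch]
    calc T * x = ℓ * t * (T * ‖Δ‖ * r) := by
          rw [show ℓ * t * (T * ‖Δ‖ * r) = ℓ * T * r * (t * ‖Δ‖) by ring, htN,
            mul_assoc _ r, ← pow_two, hr2]
          field_simp
      _ ≤ ℓ * t * (hutch (G ω) Δ - Δ.trace) :=
          mul_le_mul_of_nonneg_left (le_of_lt hω) (by positivity)
      _ = _ := by ring
  calc μ {ω | T * ‖Δ‖ * r < hutch (G ω) Δ - Δ.trace}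
      ≤ μ {ω | ENNReal.ofReal (Real.exp (T * x))
        ≤ ENNReal.ofReal (Real.exp (t * ∑ i, q i ω))} := measure_mono hsub
    _ ≤ (∫⁻ ω, ENNReal.ofReal (Real.exp (t * ∑ i, q i ω)) ∂μ)
        / ENNReal.ofReal (Real.exp (T * x)) :=
        meas_ge_le_lintegral_div (by fun_prop) (by simp [Real.exp_pos]) ENNReal.ofReal_ne_top
    _ ≤ ENNReal.ofReal (Real.exp (1544 * κ ^ 2 * x)) / ENNReal.ofReal (Real.exp (T * x)) := by
        gcongr
    _ = _ := by
        rw [← ENNReal.ofReal_div_of_pos (Real.exp_pos _), ← Real.exp_sub, hT]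
        congr 2
        ring

lemma hutch_neg {d ℓ : ℕ} (G : Matrix (Fin d) (Fin ℓ) ℝ) (Δ : Matrix (Fin d) (Fin d) ℝ) :
    hutch G (-Δ) = -hutch G Δ := by
  simp [hutch, Matrix.neg_mulVec]

/-- Hutchinson's estimator deviates from the trace by `O(‖Δ‖_F √(log (1/δ) / ℓ))` with probability
at least `1 - δ`. -/
lemma one_sub_le_measureReal_abs_hutch_sub_trace_le {Ω : Type*} [MeasurableSpace Ω]
    {μ : Measure Ω} [IsProbabilityMeasure μ] {d ℓ : ℕ} {κ : ℝ≥0} (hκ : 1 ≤ κ)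
    {G : Ω → Matrix (Fin d) (Fin ℓ) ℝ} (hG : IsSubgaussianQueryMatrix κ G μ)
    (Δ : Matrix (Fin d) (Fin d) ℝ) {δ : ℝ} (hδ : 0 < δ) (hδ2 : δ < 1 / 2)
    (hℓ : (32 * κ) ^ 2 * Real.log (1 / δ) ≤ ℓ) :
    1 - δ ≤ μ.real {ω | |hutch (G ω) Δ - Δ.trace|
      ≤ (1544 * κ ^ 2 + 2) * ‖Δ‖ * √(Real.log (1 / δ) / ℓ)} := by
  have hx : 0 < Real.log (1 / δ) := Real.log_pos (by rw [lt_div_iff₀ hδ]; linarith)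
  set B : ℝ := (1544 * κ ^ 2 + 2) * ‖Δ‖ * √(Real.log (1 / δ) / ℓ) with hB
  have h1 := measure_hutch_sub_trace_gt_le hκ hG Δ hx hℓ
  have h2 := measure_hutch_sub_trace_gt_le hκ hG (-Δ) hx hℓ
  rw [norm_neg] at h2
  simp only [hutch_neg, Matrix.trace_neg] at h2
  rw [← hB] at h1 h2
  have hexp : Real.exp (-(2 * Real.log (1 / δ))) = δ ^ 2 := by
    rw [one_div, Real.log_inv, show -(2 * -Real.log δ) = ((2 : ℕ) : ℝ) * Real.log δ by
      push_cast; ring, Real.exp_nat_mul, Real.exp_log hδ]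
  rw [hexp] at h1 h2
  have h1' := ENNReal.toReal_le_of_le_ofReal (by positivity) h1
  have h2' := ENNReal.toReal_le_of_le_ofReal (by positivity) h2
  rw [← measureReal_def] at h1' h2'
  set E : Set Ω := {ω | |hutch (G ω) Δ - Δ.trace| ≤ B} with hE
  have hcover : (Set.univ : Set Ω) ⊆ E ∪ ({ω | B < hutch (G ω) Δ - Δ.trace}
      ∪ {ω | B < -hutch (G ω) Δ - -Δ.trace}) := by
    intro ω _
    by_cases h : ω ∈ E
    · exact Or.inl h
    · have h3 : B < |hutch (G ω) Δ - Δ.trace| := not_le.1 h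
      rcases lt_abs.1 h3 with h4 | h4
      · exact Or.inr (Or.inl h4)
      · refine Or.inr (Or.inr ?_)
        change B < -hutch (G ω) Δ - -Δ.trace
        linarith
  have h5 := (measureReal_mono hcover (measure_ne_top μ _)).trans
    ((measureReal_union_le _ _).trans (add_le_add_right (measureReal_union_le _ _) _))
  rw [probReal_univ] at h5
  nlinarith

/-! ### The trace estimator -/

/-- The two bounds `‖Δ‖_F ≤ 2 ‖A - Aₖ‖_F ≤ 2 tr A / √k` turn the Frobenius-norm concentration of
Hutchinson's estimator into an error relative to `tr A`. -/
lemma one_sub_le_measureReal_abs_trace_estimate_le {Ω : Type*} [MeasurableSpace Ω]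
    {μ : Measure Ω} [IsProbabilityMeasure μ] {d e k ℓ : ℕ} (hk : 1 ≤ k)
    {A Ak Δ : Matrix (Fin d) (Fin d) ℝ} {A' : Matrix (Fin e) (Fin e) ℝ} (hA : A.PosSemidef)
    (hAk : IsBestRankApprox k A Ak) (htr : A.trace = A'.trace + Δ.trace)
    (hΔ : ‖Δ‖ ≤ 2 * ‖A - Ak‖) {κ : ℝ≥0} (hκ : 1 ≤ κ)
    {G : Ω → Matrix (Fin d) (Fin ℓ) ℝ} (hG : IsSubgaussianQueryMatrix κ G μ)
    {δ : ℝ} (hδ : 0 < δ) (hδ2 : δ < 1 / 2) (hℓ : (32 * κ) ^ 2 * Real.log (1 / δ) ≤ ℓ) :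
    1 - δ ≤ μ.real {ω | |(A'.trace + hutch (G ω) Δ) - A.trace| ≤
      2 * (1544 * κ ^ 2 + 2) * √(Real.log (1 / δ) / ((k : ℝ) * (ℓ : ℝ))) * A.trace} := by
  refine (one_sub_le_measureReal_abs_hutch_sub_trace_le hκ hG Δ hδ hδ2 hℓ).trans
    (measureReal_mono (fun ω hω => ?_) (measure_ne_top μ _))
  have hkpos : (0 : ℝ) < k := by exact_mod_cast hk
  have hnorm : ‖A - Ak‖ ≤ A.trace / √k := by
    rw [le_div_iff₀ (Real.sqrt_pos.2 hkpos)]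
    refine (sq_le_sq₀ (by positivity) hA.trace_nonneg).1 ?_
    rw [mul_pow, Real.sq_sqrt hkpos.le]
    exact hAk.sq_norm_sub_mul_le hA hk
  have hsqrt : √(Real.log (1 / δ) / ((k : ℝ) * ℓ)) = √(Real.log (1 / δ) / ℓ) / √k := by
    rw [← Real.sqrt_div' _ hkpos.le, div_div, mul_comm (ℓ : ℝ)]
  change |A'.trace + hutch (G ω) Δ - A.trace| ≤ _
  rw [show A'.trace + hutch (G ω) Δ - A.trace = hutch (G ω) Δ - Δ.trace by rw [htr]; ring]
  calc |hutch (G ω) Δ - Δ.trace|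
      ≤ (1544 * κ ^ 2 + 2) * ‖Δ‖ * √(Real.log (1 / δ) / ℓ) := hω
    _ ≤ (1544 * κ ^ 2 + 2) * (2 * (A.trace / √k)) * √(Real.log (1 / δ) / ℓ) := by
      gcongr
      linarith
    _ = _ := by rw [hsqrt]; ring

theorem theorem3 (K : ℝ≥0) :
    (∃ c C : ℝ, 0 < c ∧ 0 < C ∧
      ∀ (d e k ℓ : ℕ), 1 ≤ k →
      ∀ (A Ak Δ : Matrix (Fin d) (Fin d) ℝ) (A' : Matrix (Fin e) (Fin e) ℝ),
        A.PosSemidef → IsBestRankApprox k A Ak →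
        A.trace = A'.trace + Δ.trace → ‖Δ‖ ≤ 2 * ‖A - Ak‖ →
      ∀ δ : ℝ, 0 < δ → δ < 1 / 2 → c * Real.log (1 / δ) < (ℓ : ℝ) →
      ∀ (Ω : Type*) [MeasurableSpace Ω] (μ : Measure Ω) [IsProbabilityMeasure μ]
        (G : Ω → Matrix (Fin d) (Fin ℓ) ℝ), IsSubgaussianQueryMatrix K G μ →
        1 - δ ≤ μ.real {ω | |(A'.trace + hutch (G ω) Δ) - A.trace| ≤
          2 * C * √(Real.log (1 / δ) / ((k : ℝ) * (ℓ : ℝ))) * A.trace}) ∧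
    (∃ C₀ : ℝ, 0 < C₀ ∧
      ∀ (δ ε : ℝ), 0 < δ → δ < 1 / 2 → 0 < ε →
      ∀ (d e k ℓ : ℕ), k = ℓ → C₀ * (√(Real.log (1 / δ)) / ε + Real.log (1 / δ)) ≤ (k : ℝ) →
      ∀ (A Ak Δ : Matrix (Fin d) (Fin d) ℝ) (A' : Matrix (Fin e) (Fin e) ℝ),
        A.PosSemidef → IsBestRankApprox k A Ak →
        A.trace = A'.trace + Δ.trace → ‖Δ‖ ≤ 2 * ‖A - Ak‖ →
      ∀ (Ω : Type*) [MeasurableSpace Ω] (μ : Measure Ω) [IsProbabilityMeasure μ]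
        (G : Ω → Matrix (Fin d) (Fin ℓ) ℝ), IsSubgaussianQueryMatrix K G μ →
        1 - δ ≤ μ.real {ω | (1 - ε) * A.trace ≤ A'.trace + hutch (G ω) Δ ∧
          A'.trace + hutch (G ω) Δ ≤ (1 + ε) * A.trace}) := by
  -- Enlarging the sub-Gaussian parameter to `K + 1 ≥ 1` only weakens the hypothesis on `G`.
  have hκ : (1 : ℝ≥0) ≤ K + 1 := le_add_self
  set κ : ℝ≥0 := K + 1 with hκdef
  have hKκ : K ≤ κ := le_self_add
  refine ⟨⟨(32 * κ) ^ 2, 1544 * κ ^ 2 + 2, by positivity, by positivity, ?_⟩,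
    ⟨(32 * κ) ^ 2 + 2 * (1544 * κ ^ 2 + 2), by positivity, ?_⟩⟩
  · intro d e k ℓ hk A Ak Δ A' hA hAk htr hΔ δ hδ hδ2 hℓ Ω _ μ _ G hG
    exact one_sub_le_measureReal_abs_trace_estimate_le hk hA hAk htr hΔ hκ (hG.mono hKκ) hδ hδ2
      hℓ.le
  · intro δ ε hδ hδ2 hε d e k ℓ hkℓ hk A Ak Δ A' hA hAk htr hΔ Ω _ μ _ G hG
    subst hkℓ
    set x : ℝ := Real.log (1 / δ) with hx
    have hxpos : 0 < x := Real.log_pos (by rw [lt_div_iff₀ hδ]; linarith)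
    have hkx : (32 * κ) ^ 2 * x ≤ k := by
      refine le_trans ?_ hk
      have : 0 ≤ √x / ε := by positivity
      gcongr
      · exact le_add_of_nonneg_right (by positivity)
      · linarith
    have hkε : 2 * (1544 * κ ^ 2 + 2) * (√x / ε) ≤ k := by
      refine le_trans ?_ hk
      gcongr
      · exact le_add_of_nonneg_left (by positivity)
      · linarith
    have hkpos : (0 : ℝ) < k := lt_of_lt_of_le (by positivity) hkx
    have hk1 : 1 ≤ k := by exact_mod_cast hkpos
    refine (one_sub_le_measureReal_abs_trace_estimate_le hk1 hA hAk htr hΔ hκ (hG.mono hKκ) hδ hδ2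
      hkx).trans (measureReal_mono (fun ω hω => ?_) (measure_ne_top μ _))
    have h1 : 2 * (1544 * κ ^ 2 + 2) * √(x / (k * k)) * A.trace ≤ ε * A.trace := by
      refine mul_le_mul_of_nonneg_right ?_ hA.trace_nonneg
      rw [Real.sqrt_div' _ (by positivity), Real.sqrt_mul_self hkpos.le, ← mul_div_assoc,
        div_le_iff₀ hkpos]
      rw [← mul_div_assoc, div_le_iff₀ hε] at hkε
      linarith
    have h2 := abs_le.1 (le_trans hω h1)
    constructor <;> linarith [h2.1, h2.2]
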